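/- **Setting.** Let $C(\mathbb R_+)$ be the space of continuous functions $\mathbb R_+\to\mathbb R$ with the topology of locally uniform convergence, $(X_t)_{t\ge 0}$ the coordinate process, $(\mathcal F_t)_{t\ge 0}$ its natural filtration, and, for $x\in\mathbb R$, $\mathbb W_x$ (with expectation $\mathbb E_x$) the law on $C(\mathbb R_+)$ of standard Brownian motion started from $x$. For $x\in\mathbb R$ and $t>0$ put $$\phi_0(x,t)=\sum_{k\in\mathbb Z}(x+2kt)\,e^{-2(kx+k^2t)},\qquad \phi_0^{(c)}(x,t)=\phi_0(cx,c^2t)\quad(0<c<1).$$ Let $0<x<u$. For $c\in(0,1)$ let $T_u^{(c)}=\inf\{s\ge 0: X_s=0\text{ or }X_s=cs+u\}$ (with $\inf\emptyset=\infty$), and let $\mathbb Q^{(c)}_{x,u}$ be the probability measure on $C(\mathbb R_+)$ determined by $$\mathbb Q^{(c)}_{x,u}(A)=\mathbb E_x\!\left(\frac{\phi_0^{(c)}(X_t,\,t+\frac uc)}{\phi_0^{(c)}(x,\,\frac uc)}\,\mathbf 1_{\{T^{(c)}_u>t\}\cap A}\right),\qquad t\ge 0,\ A\in\mathcal F_t.$$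 (Under $\mathbb Q^{(c)}_{x,u}$, $(t+\frac uc,X_t)_{t\ge0}$ is a space-time Brownian motion started from $(\frac uc,x)$ and conditioned to remain in $\{(r,z):0\le z\le cr\}$.) Let $h(y)=\sin(\pi y/u)$, let $p^0_t(y,dz)=\mathbb W_y(X_t\in dz,\ T>t)$, where $T=\inf\{s\ge 0:X_s\in\{0,u\}\}$, be the semigroup of standard Brownian motion killed on the boundary of $[0,u]$, and let $$q_t(y,dz)=\frac{h(z)}{h(y)}\,e^{\frac{\pi^2}{u^2}\frac t2}\,p^0_t(y,dz),\qquad y\in(0,u),\ t\ge 0.$$ Let $\mathbb Q_{x,u}$ be the law on $C(\mathbb R_+)$ of standard Brownian motion started from $x$ and conditioned, in Doob's sense, to remain in $[0,u]$, that is, the probability measure under which $X_0=x$ almost surely and $(X_t)_{t\ge 0}$ is a Markov process with respect to $(\mathcal F_t)$ with semigroup $(q_t)_{t\ge 0}$. **Theorem.** For all real numbers $0<x<u$, $\mathbb Q^{(c)}_{x,u}$ converges weakly to $\mathbb Q_{x,u}$, as probability measures on $C(\mathbb R_+)$, when $c\to 0$, $c\in(0,1)$. -/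

import Mathlib

open MeasureTheory ProbabilityTheory Filter
open scoped NNReal ENNReal Topology

noncomputable section

namespace ConditionedBM

/-- The space `C(ℝ₊)` of real valued continuous paths, with its topology of locally uniform
convergence (the compact-open topology carried by `C(ℝ≥0, ℝ)`). -/
abbrev Path : Type := C(ℝ≥0, ℝ)

instance : MeasurableSpace Path := borel Path

instance : BorelSpace Path := ⟨rfl⟩

/-- The natural filtration `ℱ_t = σ(X_s, s ≤ t)` of the coordinate process `X_t(w) = w t`. -/
def canonicalFiltration : Filtration ℝ≥0 (inferInstance : MeasurableSpace Path) :=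
  Filtration.natural (fun (t : ℝ≥0) (w : Path) => w t)
    fun t => (continuous_eval_const t).stronglyMeasurable

/-- `W` is the Wiener measure: under `W`, the coordinate process is a standard real Brownian
motion started from `0`. -/
def IsWienerMeasure (W : Measure Path) : Prop :=
  IsBrownianReal (fun (t : ℝ≥0) (w : Path) => w t) W

/-- The law `𝕎_x` of Brownian motion started from `x`: the image of the Wiener measure `W` under
the translation `w ↦ x + w`. -/
def wienerFrom (W : Measure Path) (x : ℝ) : Measure Path :=
  W.map fun w => ContinuousMap.const ℝ≥0 x + w

/-- The function `φ₀(x, t) = ∑_{k ∈ ℤ} (x + 2kt) exp(-2(kx + k²t))`. -/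
def phi0 (x t : ℝ) : ℝ :=
  ∑' k : ℤ, (x + 2 * k * t) * Real.exp (-2 * (k * x + (k : ℝ) ^ 2 * t))

/-- The rescaled function `φ₀⁽ᶜ⁾(x, t) = φ₀(cx, c²t)`. -/
def phi0Scaled (c x t : ℝ) : ℝ := phi0 (c * x) (c ^ 2 * t)

/-- The time `inf {s ≥ 0 : X_s = 0 or X_s = c s + u}`, equal to `∞` if there is no such `s`.
For `c = 0` it is the hitting time of the boundary of `[0, u]`. -/
def exitTime (c u : ℝ) (w : Path) : ℝ≥0∞ :=
  sInf ((fun s : ℝ≥0 => (s : ℝ≥0∞)) '' {s : ℝ≥0 | w s = 0 ∨ w s = c * (s : ℝ) + u})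

/-- `Q` is the probability measure `ℚ⁽ᶜ⁾_{x,u}` given, for all `t ≥ 0` and `A ∈ ℱ_t`, by
`ℚ⁽ᶜ⁾_{x,u}(A) = 𝔼_x(φ₀⁽ᶜ⁾(X_t, t + u/c) / φ₀⁽ᶜ⁾(x, u/c) · 1_{{T > t} ∩ A})`, with
`T = inf {s ≥ 0 : X_s = 0 or X_s = c s + u}`. -/
def IsConeConditionedLaw (W : Measure Path) (c u x : ℝ) (Q : ProbabilityMeasure Path) : Prop :=
  ∀ (t : ℝ≥0) (A : Set Path), MeasurableSet[canonicalFiltration t] A →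
    (Q : Measure Path).real A =
      ∫ w in {w : Path | (t : ℝ≥0∞) < exitTime c u w} ∩ A,
        phi0Scaled c (w t) ((t : ℝ) + u / c) / phi0Scaled c x (u / c) ∂(wienerFrom W x)

/-- The semigroup `p⁰_t f(y) = 𝔼_y(f(X_t) 1_{T > t})` of Brownian motion killed on the boundary of
`[0, u]`, where `T` is the hitting time of `{0, u}`. It is used for `y ∈ (0, u)`. -/
def killedSemigroup (W : Measure Path) (u : ℝ) (t : ℝ≥0) (f : ℝ → ℝ) (y : ℝ) : ℝ :=
  ∫ w in {w : Path | (t : ℝ≥0∞) < exitTime 0 u w}, f (w t) ∂(wienerFrom W y)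

/-- The Dirichlet eigenfunction `h(x) = sin(π x / u)` of the interval `[0, u]`. -/
def intervalEigenfunction (u x : ℝ) : ℝ := Real.sin (Real.pi * (x / u))

/-- The Doob transformed semigroup
`q_t f(y) = exp((π²/u²)(t/2)) h(y)⁻¹ p⁰_t(h f)(y)`, for `y ∈ (0, u)`; in terms of kernels,
`q_t(y, dz) = (h(z)/h(y)) exp((π²/u²)(t/2)) p⁰_t(y, dz)`. -/
def doobSemigroup (W : Measure Path) (u : ℝ) (t : ℝ≥0) (f : ℝ → ℝ) (y : ℝ) : ℝ :=
  Real.exp (Real.pi ^ 2 / u ^ 2 * ((t : ℝ) / 2)) / intervalEigenfunction u y *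
    killedSemigroup W u t (fun z => intervalEigenfunction u z * f z) y

/-- `Q` is the law of Brownian motion started from `x` and conditioned, in the sense of Doob, to
remain in `[0, u]`: under `Q` the coordinate process starts from `x` and is a Markov process, with
respect to its natural filtration, whose semigroup is the Doob transformed semigroup. (Taking
`s = 0` in the Markov property shows that each `X_t` almost surely lies in `(0, u)`, where
the semigroup is meaningful.) -/
structure IsDoobConditionedLaw (W : Measure Path) (u x : ℝ) (Q : ProbabilityMeasure Path) :
    Prop where
  start : ∀ᵐ w ∂(Q : Measure Path), w 0 = x
  markov : ∀ (s t : ℝ≥0) (f : ℝ → ℝ), Measurable f → (∃ C : ℝ, ∀ z, |f z| ≤ C) →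
    (Q : Measure Path)[fun w : Path => f (w (s + t)) | canonicalFiltration s]
      =ᵐ[(Q : Measure Path)] fun w : Path => doobSemigroup W u t f (w s)

end ConditionedBM

end

/-!
On `ℱ_t`, both laws are given by densities with respect to the law `𝕎_x` of Brownian motion
started from `x`, and the densities converge.

For `ℚ⁽ᶜ⁾` the density is part of the definition. Jacobi's transformation of the theta series,
in the form of the functional equation of the odd Hurwitz kernel, turns `φ₀(a, τ)` into a sine
series in `πa/τ` with coefficients `n exp(-π²n²/(2τ))`. Along `a = c y`, `τ = c²(t + u/c)`, with
`c → 0`, the time `τ` tends to `0` and the first term dominates (`exists_phi0_bound`). Hence the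
density is nonnegative for small `c` and converges on `{T > t}` to
`exp((π²/u²)(t/2)) h(X_t) / h(x)` (`tendsto_phi0Scaled_ratio`).

For the Doob law, the Markov property of Brownian motion killed at the boundary of `[0, u]`
(`setIntegral_killedSemigroup`) and an induction on the number of times show that its
finite-dimensional laws up to time `t` are those of the measure with density
`exp((π²/u²)(t/2)) h(X_t) / h(x) · 1_{T > t}` with respect to `𝕎_x`
(`measure_cylinder_eq`, `measure_eq_doobMeasure`).

Given these, dominated convergence applied to the minimum of the two densities yields
`ℚ(A) ≤ liminf ℚ⁽ᶜ⁾(A)` for every `A ∈ ℱ_t` (`measure_le_liminf`). Taking the minimum bypasses any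
uniform bound on the densities of `ℚ⁽ᶜ⁾`, and the convergence of the indicators `1_{T⁽ᶜ⁾ > t}` on
the paths that touch `u` without crossing it. An open set of paths is an increasing union of sets each
belonging to some `ℱ_t` (`exists_monotone_approx_of_isOpen`), so the same inequality holds for all
open sets, which is one of the portmanteau criteria for weak convergence.
-/

namespace ConditionedBM

/-! ### The path space and its filtration -/

theorem measurable_eval (t : ℝ≥0) : Measurable fun w : Path => w t :=
  (continuous_eval_const t).measurable

theorem measurable_canonicalFiltration_eval {s t : ℝ≥0} (hst : s ≤ t) :
    Measurable[canonicalFiltration t] fun w : Path => w s := by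
  rw [measurable_iff_comap_le]
  exact le_iSup₂_of_le (f := fun j (_ : j ≤ t) =>
    MeasurableSpace.comap (fun w : Path => w j) inferInstance) s hst le_rfl

/-- The subbasic open sets of the compact-open topology belong to the filtration: by compactness,
`w` maps `K` into `O` if and only if `w` stays at some distance `1/n` from the complement of `O` on
a countable dense subset of `K`. -/
theorem measurableSet_canonicalFiltration_mapsTo {K : Set ℝ≥0} (hK : IsCompact K) {t : ℝ≥0}
    (hKt : ∀ s ∈ K, s ≤ t) {O : Set ℝ} (hO : IsOpen O) :
    MeasurableSet[canonicalFiltration t] {w : Path | Set.MapsTo w K O} := by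
  obtain ⟨D, hDc, hDd⟩ := TopologicalSpace.exists_countable_dense K
  have key : {w : Path | Set.MapsTo w K O} =
      ⋃ n : ℕ, ⋂ s ∈ D, (fun w : Path => w s) ⁻¹' {z | ((n : ℝ≥0∞))⁻¹ ≤ Metric.infEDist z Oᶜ} := by
    ext w
    simp only [Set.mem_ofPred_eq, Set.mem_iUnion, Set.mem_iInter, Set.mem_preimage]
    have hcont : Continuous fun s : K => Metric.infEDist (w s) Oᶜ :=
      Metric.continuous_infEDist.comp (w.continuous.comp continuous_subtype_val)
    constructor
    · intro hw
      rcases K.eq_empty_or_nonempty with rfl | hne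
      · exact ⟨0, fun s => s.2.elim⟩
      obtain ⟨s₀, hs₀, hmin⟩ := hK.exists_isMinOn hne
        (Metric.continuous_infEDist.comp w.continuous : Continuous
          fun s => Metric.infEDist (w s) Oᶜ).continuousOn
      have hpos : 0 < Metric.infEDist (w s₀) Oᶜ := by
        rw [Metric.infEDist_pos_iff_notMem_closure, hO.isClosed_compl.closure_eq]
        exact fun h => h (hw hs₀)
      obtain ⟨n, hn⟩ := ENNReal.exists_inv_nat_lt hpos.ne'
      exact ⟨n, fun s _ => hn.le.trans (hmin s.2)⟩
    · rintro ⟨n, hn⟩ s hs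
      have hcl : IsClosed {s : K | ((n : ℝ≥0∞))⁻¹ ≤ Metric.infEDist (w s) Oᶜ} :=
        isClosed_le continuous_const hcont
      have hmem : (⟨s, hs⟩ : K) ∈ {s : K | ((n : ℝ≥0∞))⁻¹ ≤ Metric.infEDist (w s) Oᶜ} :=
        hcl.closure_subset_iff.2 (fun r hr => hn r hr) (hDd _)
      have hpos : 0 < Metric.infEDist (w s) Oᶜ :=
        lt_of_lt_of_le (ENNReal.inv_pos.2 (ENNReal.natCast_ne_top n)) hmem
      rw [Metric.infEDist_pos_iff_notMem_closure, hO.isClosed_compl.closure_eq] at hpos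
      exact not_not.1 hpos
  rw [key]
  refine MeasurableSet.iUnion fun n => MeasurableSet.biInter hDc fun s _ => ?_
  exact measurable_canonicalFiltration_eval (hKt s s.2)
    (isClosed_le continuous_const Metric.continuous_infEDist).measurableSet

theorem exists_countable_cover_of_isOpen {U : Set Path} (hU : IsOpen U) :
    ∃ S : Set (Set Path), S.Countable ∧ U = ⋃₀ S ∧
      ∀ V ∈ S, ∃ t, MeasurableSet[canonicalFiltration t] V := by
  have hb := TopologicalSpace.isTopologicalBasis_of_subbasis
    (ContinuousMap.compactOpen_eq (X := ℝ≥0) (Y := ℝ))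
  obtain ⟨S, hS, rfl⟩ := hb.open_eq_sUnion hU
  obtain ⟨T, hTc, hTS, hT⟩ := TopologicalSpace.isOpen_sUnion_countable S
    fun s hs => hb.isOpen (hS hs)
  refine ⟨T, hTc, hT.symm, fun V hV => ?_⟩
  obtain ⟨f, ⟨hf, hfs⟩, rfl⟩ := hS (hTS hV)
  have hex : ∀ B ∈ f, ∃ t, MeasurableSet[canonicalFiltration t] B := by
    intro B hB
    obtain ⟨K, hK, O, hO, rfl⟩ := hfs hB
    obtain ⟨t, ht⟩ := hK.bddAbove
    exact ⟨t, measurableSet_canonicalFiltration_mapsTo hK (fun s hs => ht hs) hO⟩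
  choose! τ hτ using hex
  obtain ⟨t, ht⟩ := (hf.image τ).bddAbove
  refine ⟨t, MeasurableSet.sInter hf.countable fun B hB => ?_⟩
  exact canonicalFiltration.mono (ht (Set.mem_image_of_mem τ hB)) _ (hτ B hB)

theorem exists_monotone_approx_of_isOpen {U : Set Path} (hU : IsOpen U) :
    ∃ V : ℕ → Set Path, Monotone V ∧ U = ⋃ n, V n ∧
      ∀ n, ∃ t, MeasurableSet[canonicalFiltration t] (V n) := by
  obtain ⟨S, hSc, rfl, hS⟩ := exists_countable_cover_of_isOpen hU
  rcases S.eq_empty_or_nonempty with rfl | hne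
  · exact ⟨fun _ => ∅, monotone_const, by simp, fun _ =>
      ⟨0, @MeasurableSet.empty _ (canonicalFiltration 0)⟩⟩
  obtain ⟨f, rfl⟩ := hSc.exists_eq_range hne
  choose τ hτ using fun n => hS (f n) (Set.mem_range_self n)
  refine ⟨Set.accumulate f, Set.monotone_accumulate, ?_, fun n => ?_⟩
  · rw [Set.iUnion_accumulate, Set.sUnion_range]
  · refine ⟨(Finset.range (n + 1)).sup τ, ?_⟩
    rw [Set.accumulate_def]
    refine MeasurableSet.biUnion (Set.to_countable {k | k ≤ n}) fun k hk => ?_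
    exact canonicalFiltration.mono (Finset.le_sup (f := τ)
      (Finset.mem_range.2 (Nat.lt_succ_of_le hk))) _ (hτ k)

/-- The Borel σ-algebra of the path space is generated by the coordinates: by second countability,
every open set is a countable union of sets depending measurably on the coordinates. -/
theorem borel_path_eq_comap :
    instMeasurableSpacePath =
      MeasurableSpace.comap (fun (w : Path) (t : ℝ≥0) => w t) MeasurableSpace.pi := by
  have hle : ∀ t, canonicalFiltration t ≤
      MeasurableSpace.comap (fun (w : Path) (t : ℝ≥0) => w t) MeasurableSpace.pi := by
    intro t
    refine iSup₂_le fun s _ => ?_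
    rintro _ ⟨B, hB, rfl⟩
    exact ⟨(fun g : ℝ≥0 → ℝ => g s) ⁻¹' B, measurable_pi_apply s hB, rfl⟩
  apply le_antisymm
  · refine MeasurableSpace.generateFrom_le fun U hU => ?_
    obtain ⟨S, hSc, rfl, hS⟩ := exists_countable_cover_of_isOpen hU
    refine MeasurableSet.sUnion hSc fun V hV => ?_
    obtain ⟨t, ht⟩ := hS V hV
    exact hle t _ ht
  · exact (measurable_pi_lambda _ measurable_eval).comap_le

theorem measurable_path_of_eval {α : Type*} [MeasurableSpace α] {f : α → Path}
    (hf : ∀ t, Measurable fun a => f a t) : Measurable f := by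
  rw [borel_path_eq_comap, measurable_comap_iff]
  exact measurable_pi_lambda _ hf

/-! ### Exit times -/

/-- The infimum defining the exit time is attained, because it is taken over a closed set. -/
theorem lt_exitTime_iff {c u : ℝ} {w : Path} {t : ℝ≥0} :
    (t : ℝ≥0∞) < exitTime c u w ↔ ∀ s ≤ t, w s ≠ 0 ∧ w s ≠ c * (s : ℝ) + u := by
  set S := {s : ℝ≥0 | w s = 0 ∨ w s = c * (s : ℝ) + u} with hS
  have hSc : IsClosed S := by
    refine (isClosed_eq w.continuous continuous_const).union
      (isClosed_eq w.continuous (by fun_prop))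
  have h1 : (∀ s ≤ t, w s ≠ 0 ∧ w s ≠ c * (s : ℝ) + u) ↔ ∀ s ∈ S, t < s := by
    refine forall_congr' fun s => ?_
    rw [← not_or, ← not_le, imp_not_comm]; rfl
  rw [h1]
  constructor
  · intro h s hs
    exact ENNReal.coe_lt_coe.1 (h.trans_le (sInf_le (Set.mem_image_of_mem _ hs)))
  · intro h
    rcases S.eq_empty_or_nonempty with he | hne
    · have : exitTime c u w = ⊤ := by
        unfold exitTime; rw [← hS, he]; simp
      rw [this]; exact ENNReal.coe_lt_top
    · have hmem := hSc.csInf_mem hne (OrderBot.bddBelow S)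
      refine (ENNReal.coe_lt_coe.2 (h _ hmem)).trans_le (le_sInf ?_)
      rintro _ ⟨s, hs, rfl⟩
      exact ENNReal.coe_le_coe.2 (csInf_le (OrderBot.bddBelow S) hs)

theorem isOpen_lt_exitTime (c u : ℝ) (t : ℝ≥0) :
    IsOpen {w : Path | (t : ℝ≥0∞) < exitTime c u w} := by
  let l : C(ℝ≥0, ℝ) := ⟨fun s => c * (s : ℝ) + u, by fun_prop⟩
  have h1 : IsOpen {w : Path | Set.MapsTo w (Set.Icc 0 t) {0}ᶜ} :=
    ContinuousMap.isOpen_setOfPred_mapsTo isCompact_Icc isOpen_compl_singleton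
  have h2 : IsOpen ((fun w : Path => w - l) ⁻¹' {w : Path | Set.MapsTo w (Set.Icc 0 t) {0}ᶜ}) :=
    h1.preimage (by fun_prop)
  convert! h1.inter h2 using 1
  ext w
  simp only [Set.mem_ofPred_eq, lt_exitTime_iff, Set.mem_inter_iff, Set.mem_preimage, Set.MapsTo,
    Set.mem_Icc, zero_le, true_and, Set.mem_compl_iff, Set.mem_singleton_iff,
    ContinuousMap.sub_apply, sub_eq_zero, l, ContinuousMap.coe_mk]
  exact ⟨fun h => ⟨fun s hs => (h s hs).1, fun s hs => (h s hs).2⟩,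
    fun h s hs => ⟨h.1 hs, h.2 hs⟩⟩

theorem measurableSet_lt_exitTime (c u : ℝ) (t : ℝ≥0) :
    MeasurableSet {w : Path | (t : ℝ≥0∞) < exitTime c u w} :=
  (isOpen_lt_exitTime c u t).measurableSet

theorem measurableSet_canonicalFiltration_lt_exitTime_zero (u : ℝ) (t : ℝ≥0) :
    MeasurableSet[canonicalFiltration t] {w : Path | (t : ℝ≥0∞) < exitTime 0 u w} := by
  convert measurableSet_canonicalFiltration_mapsTo (isCompact_Icc (a := 0) (b := t))
    (fun s hs => hs.2) (O := {0, u}ᶜ) (Set.toFinite _).isClosed.isOpen_compl using 1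
  ext w
  simp [lt_exitTime_iff, Set.MapsTo]

/-- Up to its exit time, a path started in `(0, u)` stays in the moving interval
`(0, c s + u)`, by the intermediate value theorem. -/
theorem mem_Ioo_of_lt_exitTime {c u x : ℝ} (hx : 0 < x) (hxu : x < u) {w : Path} (hw0 : w 0 = x)
    {t : ℝ≥0} (ht : (t : ℝ≥0∞) < exitTime c u w) {s : ℝ≥0} (hs : s ≤ t) :
    w s ∈ Set.Ioo 0 (c * s + u) := by
  rw [lt_exitTime_iff] at ht
  constructor
  · by_contra! hneg
    obtain ⟨r, hr, hr0⟩ := intermediate_value_Icc' zero_le w.continuous.continuousOn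
      (show (0 : ℝ) ∈ Set.Icc (w s) (w 0) from ⟨hneg, hw0 ▸ hx.le⟩)
    exact (ht r (hr.2.trans hs)).1 hr0
  · by_contra! hge
    obtain ⟨r, hr, hr0⟩ := intermediate_value_Icc zero_le
      (f := fun r : ℝ≥0 => w r - (c * r + u)) (by fun_prop)
      (show (0 : ℝ) ∈ Set.Icc (w 0 - (c * (0 : ℝ≥0) + u)) (w s - (c * s + u)) from
        ⟨by rw [hw0]; simp; linarith, by linarith⟩)
    exact (ht r (hr.2.trans hs)).2 (sub_eq_zero.1 hr0)

/-! ### The Markov property of Brownian motion -/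

/-- The path `r ↦ w (s + r) - w s` of the increments of `w` after time `s`. -/
def shiftIncrement (s : ℝ≥0) (w : Path) : Path :=
  ⟨fun r => w (s + r) - w s, by fun_prop⟩

@[simp]
theorem shiftIncrement_apply (s r : ℝ≥0) (w : Path) :
    shiftIncrement s w r = w (s + r) - w s := rfl

theorem measurable_shiftIncrement (s : ℝ≥0) : Measurable (shiftIncrement s) :=
  measurable_path_of_eval fun r => (measurable_eval (s + r)).sub (measurable_eval s)

theorem IsWienerMeasure.isProbabilityMeasure {W : Measure Path} (hW : IsWienerMeasure W) :
    IsProbabilityMeasure W :=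
  hW.toIsPreBrownianReal.isGaussianProcess.isProbabilityMeasure

theorem IsWienerMeasure.map_shiftIncrement {W : Measure Path} (hW : IsWienerMeasure W)
    (s : ℝ≥0) : W.map (shiftIncrement s) = W := by
  have := hW.isProbabilityMeasure
  have hcoe : Measurable fun (w : Path) (t : ℝ≥0) => w t := measurable_pi_lambda _ measurable_eval
  have hmap : W.map (fun w t => shiftIncrement s w t) =
      W.map (fun (w : Path) (t : ℝ≥0) => w t) := by
    rw [map_eq_iff_forall_finset_map_restrict_eq (X := fun t w => shiftIncrement s w t)
      (Y := fun t w => w t) (hcoe.comp (measurable_shiftIncrement s)).aemeasurable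
      hcoe.aemeasurable]
    intro I
    rw [(hW.toIsPreBrownianReal.hasLaw I).map_eq]
    exact ((hW.toIsPreBrownianReal.shift s).hasLaw I).map_eq
  ext A hA
  rw [borel_path_eq_comap] at hA
  obtain ⟨B, hB, rfl⟩ := hA
  rw [← Measure.map_apply hcoe hB, ← Measure.map_apply hcoe hB,
    Measure.map_map hcoe (measurable_shiftIncrement s)]
  exact congrArg (fun μ => μ B) hmap

theorem IsWienerMeasure.measure_inter_shiftIncrement {W : Measure Path} (hW : IsWienerMeasure W)
    {s : ℝ≥0} {A C : Set Path} (hA : MeasurableSet[canonicalFiltration s] A)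
    (hC : MeasurableSet C) : W (A ∩ shiftIncrement s ⁻¹' C) = W A * W C := by
  have hind := hW.toIsPreBrownianReal.indepFun_shift s
  rw [canonicalFiltration, Filtration.natural_eq_comap] at hA
  obtain ⟨B, hB, rfl⟩ := hA
  have hC' := hC
  rw [borel_path_eq_comap] at hC'
  obtain ⟨D, hD, rfl⟩ := hC'
  have h := hind.measure_inter_preimage_eq_mul _ _ hD hB
  rw [Set.inter_comm, mul_comm]
  refine h.trans ?_
  congr 1
  conv_rhs => rw [← hW.map_shiftIncrement s, Measure.map_apply (measurable_shiftIncrement s) hC]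
  rfl

theorem measurable_const_add (y : ℝ) :
    Measurable fun w : Path => ContinuousMap.const ℝ≥0 y + w :=
  (by fun_prop : Continuous fun w : Path => ContinuousMap.const ℝ≥0 y + w).measurable

theorem measurable_canonicalFiltration_const_add (y : ℝ) (s : ℝ≥0) :
    Measurable[canonicalFiltration s, canonicalFiltration s]
      fun w : Path => ContinuousMap.const ℝ≥0 y + w := by
  refine Measurable.of_comap_le ?_
  conv_lhs => simp only [canonicalFiltration, Filtration.natural]
  rw [MeasurableSpace.comap_iSup]
  refine iSup_le fun r => ?_
  rw [MeasurableSpace.comap_iSup]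
  refine iSup_le fun hr => ?_
  rw [MeasurableSpace.comap_comp]
  exact ((measurable_canonicalFiltration_eval hr).const_add y).comap_le

theorem wienerFrom_inter_shiftIncrement {W : Measure Path} (hW : IsWienerMeasure W) (x : ℝ)
    {s : ℝ≥0} {A C : Set Path} (hA : MeasurableSet[canonicalFiltration s] A)
    (hC : MeasurableSet C) :
    wienerFrom W x (A ∩ shiftIncrement s ⁻¹' C) = wienerFrom W x A * W C := by
  have hA' := canonicalFiltration.le s _ hA
  rw [wienerFrom, Measure.map_apply (measurable_const_add x)
    (hA'.inter (measurable_shiftIncrement s hC)), Measure.map_apply (measurable_const_add x) hA',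
    ← hW.measure_inter_shiftIncrement (measurable_canonicalFiltration_const_add x s hA) hC]
  congr 1
  ext w
  have : shiftIncrement s (ContinuousMap.const ℝ≥0 x + w) = shiftIncrement s w := by
    ext r; simp
  simp [this]

theorem isProbabilityMeasure_wienerFrom {W : Measure Path} (hW : IsWienerMeasure W) (x : ℝ) :
    IsProbabilityMeasure (wienerFrom W x) := by
  have := hW.isProbabilityMeasure
  exact Measure.isProbabilityMeasure_map (measurable_const_add x).aemeasurable

theorem wienerFrom_eval_zero {W : Measure Path} (hW : IsWienerMeasure W) (x : ℝ) :
    ∀ᵐ w ∂(wienerFrom W x), w 0 = x := by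
  rw [wienerFrom, ae_map_iff (measurable_const_add x).aemeasurable
    (p := fun w : Path => w 0 = x) (measurable_eval 0 (measurableSet_singleton x))]
  filter_upwards [hW.toIsPreBrownianReal.eval_zero_ae_eq_zero] with w hw
  simp [hw]

/-- Under `𝕎_x` restricted to an event of the past of `s`, the increments after time `s` are
independent of the position at time `s` and have the law of a Brownian motion started from `0`. -/
theorem map_eval_shiftIncrement {W : Measure Path} (hW : IsWienerMeasure W) (x : ℝ) {s : ℝ≥0}
    {A : Set Path} (hA : MeasurableSet[canonicalFiltration s] A) :
    ((wienerFrom W x).restrict A).map (fun w => (w s, shiftIncrement s w)) =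
      (((wienerFrom W x).restrict A).map fun w => w s).prod W := by
  have := hW.isProbabilityMeasure
  have := isProbabilityMeasure_wienerFrom hW x
  have hpair : Measurable fun w : Path => (w s, shiftIncrement s w) :=
    (measurable_eval s).prodMk (measurable_shiftIncrement s)
  refine (Measure.prod_eq fun B C hB hC => ?_).symm
  rw [Measure.map_apply hpair (hB.prod hC), Measure.map_apply (measurable_eval s) hB,
    Measure.restrict_apply (hpair (hB.prod hC)), Measure.restrict_apply (measurable_eval s hB),
    ← wienerFrom_inter_shiftIncrement hW x
      ((measurable_canonicalFiltration_eval le_rfl hB).inter hA) hC]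
  congr 1
  ext w
  simp only [Set.mem_inter_iff, Set.mem_preimage, Set.mem_prod]
  tauto

/-- The Markov property of Brownian motion at time `s`. The path
`const (w s) + shiftIncrement s w` is the shifted path `r ↦ w (s + r)`. -/
theorem setIntegral_wienerFrom_shift {W : Measure Path} (hW : IsWienerMeasure W) (x : ℝ)
    {s : ℝ≥0} {A : Set Path} (hA : MeasurableSet[canonicalFiltration s] A) {G : Path → ℝ}
    (hG : Measurable G) {M : ℝ} (hM : ∀ w, |G w| ≤ M) :
    ∫ w in A, G (ContinuousMap.const ℝ≥0 (w s) + shiftIncrement s w) ∂(wienerFrom W x) =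
      ∫ w in A, ∫ w', G w' ∂(wienerFrom W (w s)) ∂(wienerFrom W x) := by
  have := hW.isProbabilityMeasure
  have := isProbabilityMeasure_wienerFrom hW x
  have hpair : Measurable fun w : Path => (w s, shiftIncrement s w) :=
    (measurable_eval s).prodMk (measurable_shiftIncrement s)
  have := Measure.isFiniteMeasure_map ((wienerFrom W x).restrict A) (fun w : Path => w s)
  have hadd : Measurable fun p : ℝ × Path => ContinuousMap.const ℝ≥0 p.1 + p.2 :=
    measurable_path_of_eval fun t => measurable_fst.add ((measurable_eval t).comp measurable_snd)
  have hGadd : Measurable fun p : ℝ × Path => G (ContinuousMap.const ℝ≥0 p.1 + p.2) := hG.comp hadd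
  have hint : Integrable (fun p : ℝ × Path => G (ContinuousMap.const ℝ≥0 p.1 + p.2))
      ((((wienerFrom W x).restrict A).map fun w => w s).prod W) :=
    Integrable.of_bound hGadd.aestronglyMeasurable M (Eventually.of_forall fun p => hM _)
  calc ∫ w in A, G (ContinuousMap.const ℝ≥0 (w s) + shiftIncrement s w) ∂(wienerFrom W x)
      = ∫ p, G (ContinuousMap.const ℝ≥0 p.1 + p.2)
          ∂((((wienerFrom W x).restrict A).map fun w => w s).prod W) := by
        rw [← map_eval_shiftIncrement hW x hA,
          integral_map hpair.aemeasurable hGadd.aestronglyMeasurable]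
    _ = ∫ y, ∫ w', G (ContinuousMap.const ℝ≥0 y + w') ∂W
          ∂(((wienerFrom W x).restrict A).map fun w => w s) := integral_prod _ hint
    _ = ∫ w in A, ∫ w', G (ContinuousMap.const ℝ≥0 (w s) + w') ∂W ∂(wienerFrom W x) := by
        rw [integral_map (measurable_eval s).aemeasurable]
        exact (hGadd.stronglyMeasurable.integral_prod_right' (ν := W)).aestronglyMeasurable
    _ = _ := by
        refine integral_congr_ae (Eventually.of_forall fun w => ?_)
        simp only [wienerFrom]
        rw [integral_map (measurable_const_add _).aemeasurable hG.aestronglyMeasurable]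

/-! ### The killed semigroup -/

theorem killedSemigroup_eq_integral {W : Measure Path} (u : ℝ) (t : ℝ≥0) (f : ℝ → ℝ) (y : ℝ) :
    killedSemigroup W u t f y = ∫ w, {w : Path | (t : ℝ≥0∞) < exitTime 0 u w}.indicator
      (fun w => f (w t)) w ∂(wienerFrom W y) := by
  rw [killedSemigroup, integral_indicator (measurableSet_lt_exitTime 0 u t)]

theorem measurable_killedSemigroup {W : Measure Path} (hW : IsWienerMeasure W) (u : ℝ) (t : ℝ≥0)
    {f : ℝ → ℝ} (hf : Measurable f) : Measurable (killedSemigroup W u t f) := by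
  have := hW.isProbabilityMeasure
  have hG : Measurable ({w : Path | (t : ℝ≥0∞) < exitTime 0 u w}.indicator fun w => f (w t)) :=
    (hf.comp (measurable_eval t)).indicator (measurableSet_lt_exitTime 0 u t)
  have hadd : Measurable fun p : ℝ × Path => ContinuousMap.const ℝ≥0 p.1 + p.2 :=
    measurable_path_of_eval fun t => measurable_fst.add ((measurable_eval t).comp measurable_snd)
  have h := ((hG.comp hadd).stronglyMeasurable.integral_prod_right' (ν := W)).measurable
  convert! h using 1
  ext y
  rw [killedSemigroup_eq_integral, wienerFrom,
    integral_map (measurable_const_add _).aemeasurable hG.aestronglyMeasurable]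
  rfl

theorem lt_exitTime_zero_add_iff {u : ℝ} {s t : ℝ≥0} {w : Path} :
    ((s + t : ℝ≥0) : ℝ≥0∞) < exitTime 0 u w ↔ (s : ℝ≥0∞) < exitTime 0 u w ∧
      (t : ℝ≥0∞) < exitTime 0 u (ContinuousMap.const ℝ≥0 (w s) + shiftIncrement s w) := by
  simp only [lt_exitTime_iff, zero_mul, zero_add, ContinuousMap.add_apply,
    ContinuousMap.const_apply, shiftIncrement_apply, add_sub_cancel]
  constructor
  · intro h
    exact ⟨fun r hr => h r (hr.trans le_self_add), fun r hr => h _ (by gcongr)⟩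
  · rintro ⟨h1, h2⟩ r hr
    rcases le_total r s with hrs | hrs
    · exact h1 r hrs
    · obtain ⟨d, rfl⟩ := exists_add_of_le hrs
      exact h2 d (le_of_add_le_add_left hr)

/-- The Markov property of Brownian motion killed on the boundary of `[0, u]`. -/
theorem setIntegral_killedSemigroup {W : Measure Path} (hW : IsWienerMeasure W) (x u : ℝ)
    {s : ℝ≥0} (t : ℝ≥0) {A : Set Path} (hA : MeasurableSet[canonicalFiltration s] A) {f : ℝ → ℝ}
    (hf : Measurable f) {M : ℝ} (hM : ∀ z, |f z| ≤ M) :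
    ∫ w in {w : Path | (s : ℝ≥0∞) < exitTime 0 u w} ∩ A, killedSemigroup W u t f (w s)
        ∂(wienerFrom W x) =
      ∫ w in {w : Path | ((s + t : ℝ≥0) : ℝ≥0∞) < exitTime 0 u w} ∩ A, f (w (s + t))
        ∂(wienerFrom W x) := by
  have hM0 : 0 ≤ M := (abs_nonneg _).trans (hM 0)
  have hsA := (measurableSet_canonicalFiltration_lt_exitTime_zero u s).inter hA
  have hA' := canonicalFiltration.le s _ hA
  simp only [killedSemigroup_eq_integral]
  rw [← setIntegral_wienerFrom_shift hW x hsA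
    (Measurable.indicator (f := fun w : Path => f (w t)) (hf.comp (measurable_eval t))
      (measurableSet_lt_exitTime 0 u t)) (M := M),
    ← integral_indicator (canonicalFiltration.le s _ hsA),
    ← integral_indicator ((measurableSet_lt_exitTime 0 u (s + t)).inter hA')]
  · congr 1
    ext w
    have := lt_exitTime_zero_add_iff (u := u) (s := s) (t := t) (w := w)
    by_cases h1 : w ∈ A <;> by_cases h2 : (s : ℝ≥0∞) < exitTime 0 u w <;>
    by_cases h3 : (t : ℝ≥0∞) < exitTime 0 u (ContinuousMap.const ℝ≥0 (w s) + shiftIncrement s w) <;>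
    simp only [h1, h2, h3, Set.indicator, Set.mem_inter_iff, Set.mem_ofPred_eq, this, and_true,
      and_false, if_true, if_false, ContinuousMap.add_apply, ContinuousMap.const_apply,
      shiftIncrement_apply, add_sub_cancel]
  · intro w
    by_cases h : (t : ℝ≥0∞) < exitTime 0 u w
    · rw [Set.indicator_of_mem (by exact h)]; exact hM _
    · rw [Set.indicator_of_notMem (by exact h)]; simpa using hM0

/-! ### Asymptotics of `phi0` for small times -/

/-- The amplitude of the leading term of `phi0 a τ` as `τ → 0`, apart from the factor
`exp (a² / (2τ))`. -/
noncomputable def phi0Coeff (τ : ℝ) : ℝ :=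
  4 * τ * (Real.pi / (2 * τ)) ^ (3 / 2 : ℝ) * Real.exp (-Real.pi ^ 2 / (2 * τ))

theorem phi0Coeff_pos {τ : ℝ} (hτ : 0 < τ) : 0 < phi0Coeff τ := by
  have := Real.pi_pos
  unfold phi0Coeff; positivity

/-- Jacobi's transformation of `phi0`. The factor `exp (-π² / (2τ))` of the term `n = 1` is part
of `phi0Coeff`, which lowers the exponent `n²` to `n² - 1`. -/
theorem hasSum_phi0 (a : ℝ) {τ : ℝ} (hτ : 0 < τ) :
    HasSum (fun n : ℕ => phi0Coeff τ * Real.exp (a ^ 2 / (2 * τ)) *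
      (n * Real.sin (n * (Real.pi * (a / τ))) *
        Real.exp (-Real.pi ^ 2 / (2 * τ)) ^ ((n : ℝ) ^ 2 - 1))) (phi0 a τ) := by
  have hpi := Real.pi_pos
  have hx : 0 < 2 * τ / Real.pi := by positivity
  have h1 := (HurwitzZeta.hasSum_int_oddKernel (a / (2 * τ)) hx).mul_left
    (2 * τ * Real.exp (a ^ 2 / (2 * τ)))
  have h2 := (HurwitzZeta.hasSum_nat_sinKernel (a / (2 * τ)) (one_div_pos.2 hx)).mul_left
    (2 * τ * Real.exp (a ^ 2 / (2 * τ)) * (1 / (2 * τ / Real.pi) ^ (3 / 2 : ℝ)))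
  rw [mul_assoc (2 * τ * _), ← HurwitzZeta.oddKernel_functional_equation] at h2
  have h3 : phi0 a τ = 2 * τ * Real.exp (a ^ 2 / (2 * τ)) *
      HurwitzZeta.oddKernel (a / (2 * τ) : ℝ) (2 * τ / Real.pi) := by
    rw [← h1.tsum_eq, phi0]
    refine tsum_congr fun k => ?_
    have e : 2 * τ * Real.exp (a ^ 2 / (2 * τ)) * ((k + a / (2 * τ)) *
        Real.exp (-Real.pi * (k + a / (2 * τ)) ^ 2 * (2 * τ / Real.pi))) =
        (2 * τ * (k + a / (2 * τ))) * (Real.exp (a ^ 2 / (2 * τ)) *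
        Real.exp (-Real.pi * (k + a / (2 * τ)) ^ 2 * (2 * τ / Real.pi))) := by ring
    rw [e, ← Real.exp_add]
    congr 1
    · field_simp
      ring
    · congr 1
      field_simp
      ring
  rw [h3]
  refine h2.congr_fun fun n => ?_
  have e1 : (1 / (2 * τ / Real.pi) ^ (3 / 2 : ℝ)) = (Real.pi / (2 * τ)) ^ (3 / 2 : ℝ) := by
    rw [one_div, ← Real.inv_rpow hx.le, inv_div]
  have e2 : Real.exp (-Real.pi * n ^ 2 * (1 / (2 * τ / Real.pi))) =
      Real.exp (-Real.pi ^ 2 / (2 * τ)) *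
        Real.exp (-Real.pi ^ 2 / (2 * τ)) ^ ((n : ℝ) ^ 2 - 1) := by
    rw [← Real.exp_mul, ← Real.exp_add]
    congr 1
    field_simp
    ring
  have e3 : 2 * Real.pi * (a / (2 * τ)) * n = n * (Real.pi * (a / τ)) := by
    field_simp
  rw [e1, e2, e3, phi0Coeff]
  ring

theorem abs_sin_nat_mul_le (n : ℕ) (θ : ℝ) : |Real.sin (n * θ)| ≤ n * |Real.sin θ| := by
  induction n with
  | zero => simp
  | succ n ih =>
    push_cast
    rw [add_mul, one_mul, Real.sin_add]
    refine (abs_add_le _ _).trans ?_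
    rw [abs_mul, abs_mul, add_mul, one_mul]
    have h1 := Real.abs_cos_le_one θ
    have h2 := Real.abs_cos_le_one (n * θ)
    have h3 := abs_nonneg (Real.sin (n * θ))
    have h4 := abs_nonneg (Real.sin θ)
    nlinarith

/-- The term `n = 1` of the sine series of `phi0` dominates as `τ → 0`. The error is relative to
`|sin (πa/τ)|`, so the estimate also controls the sign of `phi0` near the endpoints of `[0, τ]`. -/
theorem exists_phi0_bound : ∃ C : ℝ, 0 < C ∧ ∀ a τ : ℝ, 0 < τ →
    Real.exp (-Real.pi ^ 2 / (2 * τ)) ≤ 1 / 2 →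
    |phi0 a τ / (phi0Coeff τ * Real.exp (a ^ 2 / (2 * τ))) - Real.sin (Real.pi * (a / τ))| ≤
      C * Real.exp (-Real.pi ^ 2 / (2 * τ)) * |Real.sin (Real.pi * (a / τ))| := by
  have hsum : Summable fun n : ℕ => 4 * ((n : ℝ) ^ 2 * (1 / 2 : ℝ) ^ n) :=
    by
    have h : ‖(1 / 2 : ℝ)‖ < 1 := by rw [Real.norm_eq_abs]; norm_num
    exact (summable_pow_mul_geometric_of_norm_lt_one 2 h).mul_left 4
  refine ⟨(∑' n : ℕ, 4 * ((n : ℝ) ^ 2 * (1 / 2 : ℝ) ^ n)) + 1,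
    add_pos_of_nonneg_of_pos (tsum_nonneg fun n => by positivity) one_pos, fun a τ hτ hq => ?_⟩
  set q := Real.exp (-Real.pi ^ 2 / (2 * τ)) with hqd
  set θ := Real.pi * (a / τ)
  have hq0 : 0 < q := Real.exp_pos _
  have hK : 0 < phi0Coeff τ * Real.exp (a ^ 2 / (2 * τ)) :=
    mul_pos (phi0Coeff_pos hτ) (Real.exp_pos _)
  have h := (hasSum_phi0 a hτ).div_const (phi0Coeff τ * Real.exp (a ^ 2 / (2 * τ)))
  simp only [mul_div_cancel_left₀ _ hK.ne'] at h
  have h' := h.sub (hasSum_ite_eq 1 (Real.sin θ))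
  have hterm : ∀ n : ℕ, ‖n * Real.sin (n * θ) * q ^ ((n : ℝ) ^ 2 - 1) -
      (if n = 1 then Real.sin θ else 0)‖ ≤
      q * |Real.sin θ| * (4 * ((n : ℝ) ^ 2 * (1 / 2 : ℝ) ^ n)) := by
    intro n
    rcases Nat.lt_or_ge n 2 with hn | hn
    · interval_cases n
      · simp
      · simp; positivity
    · rw [if_neg (by omega), sub_zero, Real.norm_eq_abs, abs_mul, abs_mul, Nat.abs_cast,
        abs_of_pos (Real.rpow_pos_of_pos hq0 _)]
      have hn' : (2 : ℝ) ≤ n := by exact_mod_cast hn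
      have hpow : q ^ ((n : ℝ) ^ 2 - 1) ≤ q * (4 * (1 / 2 : ℝ) ^ n) := by
        have e : (n : ℝ) ^ 2 - 1 = 1 + ((n : ℝ) ^ 2 - 2) := by ring
        rw [e, Real.rpow_add hq0, Real.rpow_one]
        refine mul_le_mul_of_nonneg_left ?_ hq0.le
        calc q ^ ((n : ℝ) ^ 2 - 2) ≤ (1 / 2 : ℝ) ^ ((n : ℝ) ^ 2 - 2) :=
              Real.rpow_le_rpow hq0.le hq (by nlinarith)
          _ ≤ (1 / 2 : ℝ) ^ ((n : ℝ) - 2) :=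
              Real.rpow_le_rpow_of_exponent_ge (by norm_num) (by norm_num) (by nlinarith)
          _ = 4 * (1 / 2 : ℝ) ^ n := by
              rw [Real.rpow_sub (by norm_num), Real.rpow_natCast]; norm_num; ring
      calc n * |Real.sin (n * θ)| * q ^ ((n : ℝ) ^ 2 - 1)
          ≤ n * (n * |Real.sin θ|) * (q * (4 * (1 / 2 : ℝ) ^ n)) := by
            gcongr
            exact abs_sin_nat_mul_le n θ
        _ = _ := by ring
  have hb := tsum_of_norm_bounded (hsum.hasSum.mul_left (q * |Real.sin θ|)) hterm
  rw [h'.tsum_eq, Real.norm_eq_abs] at hb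
  refine hb.trans ?_
  have : 0 ≤ q * |Real.sin θ| := by positivity
  nlinarith

theorem tendsto_exp_neg_div_nhdsGT_zero :
    Tendsto (fun τ : ℝ => Real.exp (-Real.pi ^ 2 / (2 * τ))) (𝓝[>] 0) (𝓝 0) := by
  refine Real.tendsto_exp_atBot.comp ?_
  have h : Tendsto (fun τ : ℝ => (-Real.pi ^ 2 / 2) * τ⁻¹) (𝓝[>] 0) atBot :=
    tendsto_inv_nhdsGT_zero.const_mul_atTop_of_neg (by have := Real.pi_pos; nlinarith)
  refine h.congr fun τ => ?_
  rw [div_mul_eq_mul_div, div_eq_mul_inv, div_eq_mul_inv, mul_inv]; ring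

theorem eventually_phi0_nonneg :
    ∀ᶠ τ in 𝓝[>] (0 : ℝ), ∀ a ∈ Set.Icc 0 τ, 0 ≤ phi0 a τ := by
  obtain ⟨C, hC, hb⟩ := exists_phi0_bound
  have hlim := tendsto_exp_neg_div_nhdsGT_zero
  filter_upwards [self_mem_nhdsWithin, hlim.eventually_le_const (u := 1 / 2) (by norm_num),
    hlim.eventually_le_const (u := 1 / C) (by positivity)] with τ hτ hq hqC a ha
  rw [Set.mem_Ioi] at hτ
  have hK : 0 < phi0Coeff τ * Real.exp (a ^ 2 / (2 * τ)) :=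
    mul_pos (phi0Coeff_pos hτ) (Real.exp_pos _)
  have hs : 0 ≤ Real.sin (Real.pi * (a / τ)) := by
    refine Real.sin_nonneg_of_nonneg_of_le_pi
      (mul_nonneg Real.pi_pos.le (div_nonneg ha.1 hτ.le)) ?_
    exact mul_le_of_le_one_right Real.pi_pos.le ((div_le_one hτ).2 ha.2)
  have h := hb a τ hτ hq
  rw [abs_of_nonneg hs] at h
  have h1 : C * Real.exp (-Real.pi ^ 2 / (2 * τ)) ≤ 1 := by
    rw [le_div_iff₀ hC] at hqC; linarith
  have h2 : 0 ≤ phi0 a τ / (phi0Coeff τ * Real.exp (a ^ 2 / (2 * τ))) := by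
    have := (abs_le.1 h).1
    nlinarith
  have h3 := mul_nonneg h2 hK.le
  rwa [div_mul_cancel₀ _ hK.ne'] at h3

theorem tendsto_scaledTime {u : ℝ} (hu : 0 < u) {t : ℝ} (ht : 0 ≤ t) :
    Tendsto (fun c : ℝ => c ^ 2 * (t + u / c)) (𝓝[>] 0) (𝓝[>] 0) := by
  rw [tendsto_nhdsWithin_iff]
  constructor
  · have h : Tendsto (fun c : ℝ => c ^ 2 * t + c * u) (𝓝[>] 0) (𝓝 0) := by
      have : Tendsto (fun c : ℝ => c ^ 2 * t + c * u) (𝓝 0) (𝓝 (0 ^ 2 * t + 0 * u)) :=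
        (by fun_prop : Continuous fun c : ℝ => c ^ 2 * t + c * u).tendsto 0
      simpa using this.mono_left nhdsWithin_le_nhds
    refine h.congr' ?_
    filter_upwards [self_mem_nhdsWithin] with c hc
    rw [Set.mem_Ioi] at hc
    field_simp
  · filter_upwards [self_mem_nhdsWithin] with c hc
    rw [Set.mem_Ioi] at hc ⊢
    positivity

theorem eventually_phi0Scaled_nonneg {u : ℝ} (hu : 0 < u) {t : ℝ} (ht : 0 ≤ t) :
    ∀ᶠ c in 𝓝[>] (0 : ℝ), ∀ y ∈ Set.Icc 0 (c * t + u), 0 ≤ phi0Scaled c y (t + u / c) := by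
  filter_upwards [(tendsto_scaledTime hu ht).eventually eventually_phi0_nonneg,
    self_mem_nhdsWithin] with c h hc y hy
  rw [Set.mem_Ioi] at hc
  refine h _ ⟨mul_nonneg hc.le hy.1, ?_⟩
  calc c * y ≤ c * (c * t + u) := by gcongr; exact hy.2
    _ = c ^ 2 * (t + u / c) := by field_simp

theorem tendsto_phi0Scaled_div {u : ℝ} (hu : 0 < u) {t : ℝ} (ht : 0 ≤ t) (y : ℝ) :
    Tendsto (fun c : ℝ => phi0Scaled c y (t + u / c) / phi0Coeff (c ^ 2 * (t + u / c)))
      (𝓝[>] 0) (𝓝 (intervalEigenfunction u y)) := by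
  obtain ⟨C, hC, hb⟩ := exists_phi0_bound
  have hτ := tendsto_scaledTime hu ht
  have hq := tendsto_exp_neg_div_nhdsGT_zero.comp hτ
  have hpos : ∀ᶠ c in 𝓝[>] (0 : ℝ), 0 < c := self_mem_nhdsWithin
  have hden : Tendsto (fun c : ℝ => c * t + u) (𝓝[>] 0) (𝓝 u) := by
    have : Tendsto (fun c : ℝ => c * t + u) (𝓝 0) (𝓝 (0 * t + u)) :=
      (by fun_prop : Continuous fun c : ℝ => c * t + u).tendsto 0
    simpa using this.mono_left nhdsWithin_le_nhds
  have hratio : Tendsto (fun c : ℝ => c * y / (c ^ 2 * (t + u / c))) (𝓝[>] 0) (𝓝 (y / u)) := by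
    refine (tendsto_const_nhds.div hden hu.ne').congr' ?_
    filter_upwards [hpos] with c hc
    simp only [Pi.div_apply]
    field_simp
  have hsin : Tendsto (fun c : ℝ => Real.sin (Real.pi * (c * y / (c ^ 2 * (t + u / c)))))
      (𝓝[>] 0) (𝓝 (intervalEigenfunction u y)) :=
    (Real.continuous_sin.tendsto _).comp (hratio.const_mul Real.pi)
  have hexp : Tendsto (fun c : ℝ => Real.exp ((c * y) ^ 2 / (2 * (c ^ 2 * (t + u / c)))))
      (𝓝[>] 0) (𝓝 1) := by
    rw [← Real.exp_zero]
    refine (Real.continuous_exp.tendsto _).comp ?_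
    have hid : Tendsto (fun c : ℝ => c * y / 2) (𝓝[>] 0) (𝓝 0) := by
      have : Tendsto (fun c : ℝ => c * y / 2) (𝓝 0) (𝓝 (0 * y / 2)) :=
        (by fun_prop : Continuous fun c : ℝ => c * y / 2).tendsto 0
      simpa using this.mono_left nhdsWithin_le_nhds
    have := hid.mul hratio
    rw [zero_mul] at this
    refine this.congr fun c => ?_
    rw [div_mul_div_comm, ← sq]
  have hdiff : Tendsto (fun c : ℝ => phi0Scaled c y (t + u / c) /
      (phi0Coeff (c ^ 2 * (t + u / c)) * Real.exp ((c * y) ^ 2 / (2 * (c ^ 2 * (t + u / c))))) -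
      Real.sin (Real.pi * (c * y / (c ^ 2 * (t + u / c))))) (𝓝[>] 0) (𝓝 0) := by
    refine squeeze_zero_norm' ?_ (by simpa using hq.const_mul C)
    filter_upwards [hτ.eventually self_mem_nhdsWithin,
      hq.eventually_le_const (u := 1 / 2) (by norm_num)] with c hc hc2
    refine (hb (c * y) _ hc hc2).trans ?_
    exact mul_le_of_le_one_right (mul_nonneg hC.le (Real.exp_pos _).le) (Real.abs_sin_le_one _)
  have := (hdiff.add hsin).mul hexp
  simp only [sub_add_cancel, zero_add, mul_one] at this
  refine this.congr fun c => ?_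
  rw [← div_div, div_mul_cancel₀ _ (Real.exp_pos _).ne']

theorem tendsto_phi0Coeff_ratio {u : ℝ} (hu : 0 < u) {t : ℝ} (ht : 0 ≤ t) :
    Tendsto (fun c : ℝ => phi0Coeff (c ^ 2 * (t + u / c)) / phi0Coeff (c ^ 2 * (u / c)))
      (𝓝[>] 0) (𝓝 (Real.exp (Real.pi ^ 2 / u ^ 2 * (t / 2)))) := by
  have hpi := Real.pi_pos
  have hr : Tendsto (fun c : ℝ => (c * t + u) / u) (𝓝[>] 0) (𝓝 1) := by
    have : Tendsto (fun c : ℝ => (c * t + u) / u) (𝓝 0) (𝓝 ((0 * t + u) / u)) :=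
      (by fun_prop : Continuous fun c : ℝ => (c * t + u) / u).tendsto 0
    simpa [hu.ne'] using this.mono_left nhdsWithin_le_nhds
  have hlim : Tendsto (fun c : ℝ => ((c * t + u) / u) * (((c * t + u) / u)⁻¹) ^ (3 / 2 : ℝ) *
      Real.exp (Real.pi ^ 2 / u ^ 2 * (t / 2) * ((c * t + u) / u)⁻¹)) (𝓝[>] 0)
      (𝓝 (1 * (1⁻¹) ^ (3 / 2 : ℝ) * Real.exp (Real.pi ^ 2 / u ^ 2 * (t / 2) * 1⁻¹))) := by
    have hi := hr.inv₀ one_ne_zero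
    refine (hr.mul (hi.rpow_const (Or.inl (by norm_num)))).mul ?_
    exact (Real.continuous_exp.tendsto _).comp (hi.const_mul _)
  rw [inv_one, Real.one_rpow, mul_one, mul_one, one_mul] at hlim
  refine hlim.congr' ?_
  filter_upwards [self_mem_nhdsWithin] with c hc
  rw [Set.mem_Ioi] at hc
  set r := (c * t + u) / u with hrd
  have hrpos : 0 < r := by positivity
  have e1 : c ^ 2 * (t + u / c) = r * (c * u) := by rw [hrd]; field_simp
  have e2 : c ^ 2 * (u / c) = c * u := by field_simp
  have e3 : Real.pi / (2 * (r * (c * u))) = r⁻¹ * (Real.pi / (2 * (c * u))) := by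
    field_simp
  have e4 : -Real.pi ^ 2 / (2 * (r * (c * u))) =
      Real.pi ^ 2 / u ^ 2 * (t / 2) * r⁻¹ + -Real.pi ^ 2 / (2 * (c * u)) := by
    have : c * t = (r - 1) * u := by rw [hrd]; field_simp; ring
    have ht' : t = (r - 1) * u / c := by field_simp; linarith
    rw [ht']
    field_simp
    ring
  have hcu : 0 < Real.pi / (2 * (c * u)) := by positivity
  rw [e1, e2, phi0Coeff, phi0Coeff, e3, e4, Real.mul_rpow (by positivity) hcu.le, Real.exp_add]
  have h5 := (Real.rpow_pos_of_pos hcu (3 / 2 : ℝ)).ne'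
  have h6 := (Real.exp_pos (-Real.pi ^ 2 / (2 * (c * u)))).ne'
  rw [eq_div_iff (by positivity)]
  ring

theorem intervalEigenfunction_pos {u y : ℝ} (hy : y ∈ Set.Ioo 0 u) :
    0 < intervalEigenfunction u y := by
  have hu : 0 < u := hy.1.trans hy.2
  refine Real.sin_pos_of_pos_of_lt_pi (mul_pos Real.pi_pos (div_pos hy.1 hu)) ?_
  exact mul_lt_of_lt_one_right Real.pi_pos ((div_lt_one hu).2 hy.2)

theorem tendsto_phi0Scaled_ratio {x u : ℝ} (hx : x ∈ Set.Ioo 0 u) {t : ℝ} (ht : 0 ≤ t) (y : ℝ) :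
    Tendsto (fun c : ℝ => phi0Scaled c y (t + u / c) / phi0Scaled c x (u / c)) (𝓝[>] 0)
      (𝓝 (Real.exp (Real.pi ^ 2 / u ^ 2 * (t / 2)) / intervalEigenfunction u x *
        intervalEigenfunction u y)) := by
  have hu : 0 < u := hx.1.trans hx.2
  have h1 := tendsto_phi0Scaled_div hu ht y
  have h2 := tendsto_phi0Scaled_div hu le_rfl x
  simp only [zero_add] at h2
  have h3 := (h1.div h2 (intervalEigenfunction_pos hx).ne').mul (tendsto_phi0Coeff_ratio hu ht)
  have e : Real.exp (Real.pi ^ 2 / u ^ 2 * (t / 2)) / intervalEigenfunction u x *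
      intervalEigenfunction u y = intervalEigenfunction u y / intervalEigenfunction u x *
      Real.exp (Real.pi ^ 2 / u ^ 2 * (t / 2)) := by ring
  rw [e]
  refine h3.congr' ?_
  filter_upwards [self_mem_nhdsWithin] with c hc
  rw [Set.mem_Ioi] at hc
  have k1 := (phi0Coeff_pos (τ := c ^ 2 * (t + u / c)) (by positivity)).ne'
  have k2 := (phi0Coeff_pos (τ := c ^ 2 * (u / c)) (by positivity)).ne'
  simp only [Pi.div_apply]
  rw [div_div_div_eq, div_mul_div_comm]
  rw [show phi0Scaled c y (t + u / c) * phi0Coeff (c ^ 2 * (u / c)) *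
      phi0Coeff (c ^ 2 * (t + u / c)) = phi0Scaled c y (t + u / c) *
      (phi0Coeff (c ^ 2 * (t + u / c)) * phi0Coeff (c ^ 2 * (u / c))) by ring,
    show phi0Coeff (c ^ 2 * (t + u / c)) * phi0Scaled c x (u / c) * phi0Coeff (c ^ 2 * (u / c)) =
      phi0Scaled c x (u / c) * (phi0Coeff (c ^ 2 * (t + u / c)) * phi0Coeff (c ^ 2 * (u / c)))
      by ring, mul_div_mul_right _ _ (mul_ne_zero k1 k2)]

/-! ### The Doob law as a change of measure -/

variable {W : Measure Path} {u x : ℝ}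

/-- The density `exp((π²/u²)(t/2)) h(w_t) / h(x)` of the Doob law on `ℱ_t` with respect to the law
of Brownian motion started from `x` and restricted to the event that the path has not left `(0, u)`
by time `t`. -/
noncomputable def doobDensity (u x : ℝ) (t : ℝ≥0) (w : Path) : ℝ :=
  Real.exp (Real.pi ^ 2 / u ^ 2 * ((t : ℝ) / 2)) / intervalEigenfunction u x *
    intervalEigenfunction u (w t)

/-- The measure with density `doobDensity u x t` with respect to Brownian motion started from `x`
and killed on the boundary of `[0, u]`. It depends on `t`; its restriction to `ℱ_t` is that of the
Doob law. -/
noncomputable def doobMeasure (W : Measure Path) (u x : ℝ) (t : ℝ≥0) : Measure Path :=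
  ((wienerFrom W x).restrict {w : Path | (t : ℝ≥0∞) < exitTime 0 u w}).withDensity
    fun w => ENNReal.ofReal (doobDensity u x t w)

theorem measurable_intervalEigenfunction (u : ℝ) : Measurable (intervalEigenfunction u) := by
  unfold intervalEigenfunction; fun_prop

theorem abs_intervalEigenfunction_le_one (u y : ℝ) : |intervalEigenfunction u y| ≤ 1 :=
  Real.abs_sin_le_one _

theorem measurable_doobDensity (u x : ℝ) (t : ℝ≥0) : Measurable (doobDensity u x t) :=
  ((measurable_intervalEigenfunction u).comp (measurable_eval t)).const_mul _

theorem doobDensity_le {u x : ℝ} (hx : x ∈ Set.Ioo 0 u) (t : ℝ≥0) (w : Path) :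
    doobDensity u x t w ≤
      Real.exp (Real.pi ^ 2 / u ^ 2 * ((t : ℝ) / 2)) / intervalEigenfunction u x :=
  mul_le_of_le_one_right (div_nonneg (Real.exp_pos _).le (intervalEigenfunction_pos hx).le)
    ((le_abs_self _).trans (abs_intervalEigenfunction_le_one _ _))

theorem mem_Ioo_of_lt_exitTime_zero {u x : ℝ} (hx : x ∈ Set.Ioo 0 u) {w : Path} (hw0 : w 0 = x)
    {t : ℝ≥0} (ht : (t : ℝ≥0∞) < exitTime 0 u w) {s : ℝ≥0} (hs : s ≤ t) : w s ∈ Set.Ioo 0 u := by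
  simpa using mem_Ioo_of_lt_exitTime hx.1 hx.2 hw0 ht hs

theorem doobDensity_pos {u x : ℝ} (hx : x ∈ Set.Ioo 0 u) {t : ℝ≥0} {w : Path} (hw0 : w 0 = x)
    (ht : (t : ℝ≥0∞) < exitTime 0 u w) : 0 < doobDensity u x t w :=
  mul_pos (div_pos (Real.exp_pos _) (intervalEigenfunction_pos hx))
    (intervalEigenfunction_pos (mem_Ioo_of_lt_exitTime_zero hx hw0 ht le_rfl))

theorem isFiniteMeasure_doobMeasure (hW : IsWienerMeasure W) (hx : x ∈ Set.Ioo 0 u) (t : ℝ≥0) :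
    IsFiniteMeasure (doobMeasure W u x t) := by
  have := isProbabilityMeasure_wienerFrom hW x
  refine isFiniteMeasure_withDensity (ne_of_lt ?_)
  refine (lintegral_mono fun w => ENNReal.ofReal_le_ofReal (doobDensity_le hx t w)).trans_lt ?_
  rw [lintegral_const]
  exact ENNReal.mul_lt_top ENNReal.ofReal_lt_top (measure_lt_top _ _)

theorem setIntegral_doobMeasure (hW : IsWienerMeasure W) (hx : x ∈ Set.Ioo 0 u) (t : ℝ≥0)
    {A : Set Path} (hA : MeasurableSet A) (g : Path → ℝ) :
    ∫ w in A, g w ∂(doobMeasure W u x t) =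
      ∫ w in {w : Path | (t : ℝ≥0∞) < exitTime 0 u w} ∩ A, doobDensity u x t w * g w
        ∂(wienerFrom W x) := by
  rw [doobMeasure, restrict_withDensity hA, Measure.restrict_restrict hA, Set.inter_comm,
    integral_withDensity_eq_integral_toReal_smul
      (measurable_doobDensity u x t).ennreal_ofReal (by simp)]
  refine setIntegral_congr_ae ((measurableSet_lt_exitTime 0 u t).inter hA) ?_
  filter_upwards [wienerFrom_eval_zero hW x] with w hw0 hw
  rw [ENNReal.toReal_ofReal (doobDensity_pos hx hw0 hw.1).le, smul_eq_mul]

theorem measureReal_doobMeasure (hW : IsWienerMeasure W) (hx : x ∈ Set.Ioo 0 u) (t : ℝ≥0)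
    {A : Set Path} (hA : MeasurableSet A) :
    (doobMeasure W u x t).real A =
      ∫ w in {w : Path | (t : ℝ≥0∞) < exitTime 0 u w} ∩ A, doobDensity u x t w
        ∂(wienerFrom W x) := by
  have := setIntegral_doobMeasure hW hx t hA fun _ => 1
  simpa using this

theorem doobMeasure_zero (hW : IsWienerMeasure W) (hx : x ∈ Set.Ioo 0 u) :
    doobMeasure W u x 0 = wienerFrom W x := by
  have h0 := wienerFrom_eval_zero hW x
  rw [doobMeasure, Measure.restrict_eq_self_of_ae_mem]
  · conv_rhs => rw [← withDensity_one (μ := wienerFrom W x)]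
    refine withDensity_congr_ae ?_
    filter_upwards [h0] with w hw
    have := (intervalEigenfunction_pos hx).ne'
    simp [doobDensity, hw, this]
  · filter_upwards [h0] with w hw
    rw [lt_exitTime_iff]
    intro s hs
    obtain rfl : s = 0 := le_antisymm hs zero_le
    simp [hw, hx.1.ne', hx.2.ne]

/-- The measures `doobMeasure W u x t` satisfy the Markov property with semigroup
`doobSemigroup W u`. -/
theorem setIntegral_doobSemigroup (hW : IsWienerMeasure W) (hx : x ∈ Set.Ioo 0 u) {s : ℝ≥0}
    (t : ℝ≥0) {A : Set Path} (hA : MeasurableSet[canonicalFiltration s] A) {f : ℝ → ℝ}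
    (hf : Measurable f) {M : ℝ} (hM : ∀ z, |f z| ≤ M) :
    ∫ w in A, doobSemigroup W u t f (w s) ∂(doobMeasure W u x s) =
      ∫ w in A, f (w (s + t)) ∂(doobMeasure W u x (s + t)) := by
  have hA' := canonicalFiltration.le s _ hA
  rw [setIntegral_doobMeasure hW hx s hA', setIntegral_doobMeasure hW hx (s + t) hA']
  set k := Real.exp (Real.pi ^ 2 / u ^ 2 * (((s + t : ℝ≥0) : ℝ) / 2)) / intervalEigenfunction u x
    with hk
  have hmul : ∀ z, |intervalEigenfunction u z * f z| ≤ M := fun z => by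
    rw [abs_mul]
    exact (mul_le_of_le_one_left (abs_nonneg _) (abs_intervalEigenfunction_le_one _ _)).trans (hM z)
  have h := setIntegral_killedSemigroup hW x u t hA ((measurable_intervalEigenfunction u).mul hf)
    hmul
  calc _ = ∫ w in {w : Path | (s : ℝ≥0∞) < exitTime 0 u w} ∩ A,
        k * killedSemigroup W u t (fun z => intervalEigenfunction u z * f z) (w s)
          ∂(wienerFrom W x) := by
        refine setIntegral_congr_ae ((measurableSet_lt_exitTime 0 u s).inter hA') ?_
        filter_upwards [wienerFrom_eval_zero hW x] with w hw0 hw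
        have hne := (intervalEigenfunction_pos
          (mem_Ioo_of_lt_exitTime_zero hx hw0 hw.1 le_rfl)).ne'
        rw [doobDensity, doobSemigroup, hk, NNReal.coe_add, add_div, mul_add, Real.exp_add]
        field_simp
    _ = k * ∫ w in {w : Path | ((s + t : ℝ≥0) : ℝ≥0∞) < exitTime 0 u w} ∩ A,
          intervalEigenfunction u (w (s + t)) * f (w (s + t)) ∂(wienerFrom W x) := by
        rw [integral_const_mul]; exact congrArg (k * ·) h
    _ = _ := by
        rw [← integral_const_mul]
        refine integral_congr_ae (Eventually.of_forall fun w => ?_)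
        simp only [doobDensity, hk]
        ring

theorem measure_eval_zero_mem {μ : Measure Path} [IsProbabilityMeasure μ] {x : ℝ}
    (h : ∀ᵐ w ∂μ, w 0 = x) (B : Set ℝ) :
    μ {w | w 0 ∈ B} = B.indicator 1 x := by
  have : {w : Path | w 0 ∈ B} =ᵐ[μ] {_w : Path | x ∈ B} := by
    filter_upwards [h] with w hw
    exact congrArg (· ∈ B) hw
  rw [measure_congr this]
  by_cases hx : x ∈ B <;> simp [hx]

/-- The induction step for the finite-dimensional laws. If, on an event `A` of the past of `s`, the
Doob law and `doobMeasure W u x s` give the same law to the position at time `s`, then the Doob law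
and `doobMeasure W u x (s + t)` give, on `A`, the same law to the position at time `s + t`. -/
theorem measure_inter_eval_eq {Q : ProbabilityMeasure Path} (hW : IsWienerMeasure W)
    (hx : x ∈ Set.Ioo 0 u) (hQ : IsDoobConditionedLaw W u x Q) {s : ℝ≥0} (t : ℝ≥0) {A : Set Path}
    (hA : MeasurableSet[canonicalFiltration s] A)
    (h : ∀ B : Set ℝ, MeasurableSet B → (Q : Measure Path) ({w | w s ∈ B} ∩ A) =
      doobMeasure W u x s ({w | w s ∈ B} ∩ A)) {B : Set ℝ} (hB : MeasurableSet B) :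
    (Q : Measure Path) ({w | w (s + t) ∈ B} ∩ A) =
      doobMeasure W u x (s + t) ({w | w (s + t) ∈ B} ∩ A) := by
  have := isFiniteMeasure_doobMeasure hW hx (s + t)
  have hA' := canonicalFiltration.le s _ hA
  set f : ℝ → ℝ := B.indicator 1 with hfd
  have hf : Measurable f := measurable_one.indicator hB
  have hM : ∀ z, |f z| ≤ 1 := fun z => by
    by_cases hz : z ∈ B <;> simp [hfd, hz]
  have hq : Measurable (doobSemigroup W u t f) := by
    unfold doobSemigroup
    exact ((measurable_intervalEigenfunction u).const_div _).mul
      (measurable_killedSemigroup hW u t ((measurable_intervalEigenfunction u).mul hf))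
  -- Transporting the integrals to `ℝ` along `w ↦ w s` makes any bound on `doobSemigroup W u t f`
  -- unnecessary.
  have hmap : ((Q : Measure Path).restrict A).map (fun w => w s) =
      ((doobMeasure W u x s).restrict A).map fun w => w s := by
    ext C hC
    rw [Measure.map_apply (measurable_eval s) hC, Measure.map_apply (measurable_eval s) hC,
      Measure.restrict_apply (measurable_eval s hC), Measure.restrict_apply (measurable_eval s hC)]
    exact h C hC
  have hint : Integrable (fun w : Path => f (w (s + t))) (Q : Measure Path) :=
    Integrable.of_bound (hf.comp (measurable_eval (s + t))).aestronglyMeasurable 1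
      (Eventually.of_forall fun w => hM _)
  have hind : ∀ μ : Measure Path, ∫ w in A, f (w (s + t)) ∂μ =
      μ.real ({w | w (s + t) ∈ B} ∩ A) := fun μ => by
    have e : (fun w : Path => f (w (s + t))) = {w : Path | w (s + t) ∈ B}.indicator 1 := rfl
    have hm : MeasurableSet {w : Path | w (s + t) ∈ B} := measurable_eval (s + t) hB
    rw [e, integral_indicator_one hm, measureReal_restrict_apply hm]
  have key : (Q : Measure Path).real ({w | w (s + t) ∈ B} ∩ A) =
      (doobMeasure W u x (s + t)).real ({w | w (s + t) ∈ B} ∩ A) := by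
    rw [← hind, ← hind]
    calc ∫ w in A, f (w (s + t)) ∂(Q : Measure Path)
        = ∫ w in A, doobSemigroup W u t f (w s) ∂(Q : Measure Path) := by
          rw [← setIntegral_condExp (canonicalFiltration.le s) hint hA]
          exact setIntegral_congr_ae hA' ((hQ.markov s t f hf ⟨1, hM⟩).mono fun w hw _ => hw)
      _ = ∫ w in A, doobSemigroup W u t f (w s) ∂(doobMeasure W u x s) := by
          rw [← integral_map (measurable_eval s).aemeasurable hq.aestronglyMeasurable, hmap,
            integral_map (measurable_eval s).aemeasurable hq.aestronglyMeasurable]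
      _ = _ := setIntegral_doobSemigroup hW hx t hA hf hM
  exact (measureReal_eq_measureReal_iff).1 key

/-- The finite-dimensional laws, at finitely many times including `0` and with greatest element `t`,
of the Doob law and of `doobMeasure W u x t` coincide. -/
theorem measure_cylinder_eq {Q : ProbabilityMeasure Path} (hW : IsWienerMeasure W)
    (hx : x ∈ Set.Ioo 0 u) (hQ : IsDoobConditionedLaw W u x Q) (S : Finset ℝ≥0) :
    ∀ t, IsGreatest (↑(insert 0 S) : Set ℝ≥0) t → ∀ B : ℝ≥0 → Set ℝ, (∀ s, MeasurableSet (B s)) →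
      (Q : Measure Path) {w | ∀ s ∈ insert 0 S, w s ∈ B s} =
        doobMeasure W u x t {w | ∀ s ∈ insert 0 S, w s ∈ B s} := by
  have hbase : ∀ B : Set ℝ,
      (Q : Measure Path) {w | w 0 ∈ B} = doobMeasure W u x 0 {w | w 0 ∈ B} := by
    intro B
    have := isProbabilityMeasure_wienerFrom hW x
    rw [doobMeasure_zero hW hx, measure_eval_zero_mem hQ.start,
      measure_eval_zero_mem (wienerFrom_eval_zero hW x)]
  induction S using Finset.induction_on_max with
  | empty =>
    intro t ht B _
    obtain rfl : t = 0 := by simpa using ht.1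
    simpa using hbase (B 0)
  | insert a S hmax ih =>
    intro t ht B hB
    rcases eq_or_ne a 0 with rfl | ha
    · obtain rfl : S = ∅ := Finset.eq_empty_of_forall_notMem fun r hr => not_lt_zero (hmax r hr)
      obtain rfl : t = 0 := by simpa using ht.1
      simpa using hbase (B 0)
    · have hne : (insert 0 S : Finset ℝ≥0).Nonempty := Finset.insert_nonempty 0 S
      have hs := (insert 0 S : Finset ℝ≥0).isGreatest_max' hne
      set s := (insert 0 S : Finset ℝ≥0).max' hne
      have hlt : ∀ r ∈ insert 0 S, r ≤ a := by
        intro r hr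
        rcases Finset.mem_insert.1 hr with rfl | hr
        · exact zero_le
        · exact (hmax r hr).le
      obtain ⟨d, rfl⟩ := exists_add_of_le (hlt s hs.1)
      obtain rfl : t = s + d := by
        refine ht.unique ⟨by simp, fun r hr => ?_⟩
        rw [Finset.mem_coe, Finset.insert_comm, Finset.mem_insert] at hr
        rcases hr with rfl | hr
        · exact le_rfl
        · exact hlt r hr
      have hA : MeasurableSet[canonicalFiltration s] {w : Path | ∀ r ∈ insert 0 S, w r ∈ B r} := by
        have e : {w : Path | ∀ r ∈ insert 0 S, w r ∈ B r} =
            ⋂ r ∈ insert 0 S, (fun w : Path => w r) ⁻¹' B r := by ext w; simp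
        rw [e]
        exact Finset.measurableSet_biInter _ fun r hr =>
          measurable_canonicalFiltration_eval (hs.2 hr) (hB r)
      have hsplit : ∀ (r : ℝ≥0) (C : Set ℝ), r ∈ insert 0 S →
          {w : Path | w r ∈ C} ∩ {w : Path | ∀ r ∈ insert 0 S, w r ∈ B r} =
          {w : Path | ∀ q ∈ insert 0 S, w q ∈ if q = r then C ∩ B q else B q} := by
        intro r C hr
        ext w
        constructor
        · rintro ⟨h1, h2⟩ q hq
          split_ifs with h
          · exact ⟨h ▸ h1, h2 q hq⟩
          · exact h2 q hq
        · intro h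
          refine ⟨?_, fun q hq => ?_⟩
          · have := h r hr
            rw [if_pos rfl] at this
            exact this.1
          · have := h q hq
            split_ifs at this
            · exact this.2
            · exact this
      have h := measure_inter_eval_eq hW hx hQ d hA (fun C hC => by
        rw [hsplit s C hs.1]
        exact ih s hs _ fun q => by
          split_ifs
          · exact hC.inter (hB q)
          · exact hB q) (hB (s + d))
      have e : {w : Path | ∀ r ∈ insert 0 (insert (s + d) S), w r ∈ B r} =
          {w : Path | w (s + d) ∈ B (s + d)} ∩ {w : Path | ∀ r ∈ insert 0 S, w r ∈ B r} := by
        ext w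
        rw [Finset.insert_comm]
        simp only [Finset.forall_mem_insert, Set.mem_ofPred_eq, Set.mem_inter_iff]
      rw [e]
      exact h

/-- On `ℱ_t`, the Doob law has density `doobDensity u x t` with respect to killed Brownian
motion. -/
theorem measure_eq_doobMeasure {Q : ProbabilityMeasure Path} (hW : IsWienerMeasure W)
    (hx : x ∈ Set.Ioo 0 u) (hQ : IsDoobConditionedLaw W u x Q) {t : ℝ≥0} {A : Set Path}
    (hA : MeasurableSet[canonicalFiltration t] A) :
    (Q : Measure Path) A = doobMeasure W u x t A := by
  have hle := canonicalFiltration.le t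
  have := isFiniteMeasure_doobMeasure hW hx t
  have hgreat : ∀ J : Finset ℝ≥0, (↑J : Set ℝ≥0) ⊆ Set.Iic t →
      IsGreatest (↑(insert 0 (insert t J)) : Set ℝ≥0) t := by
    intro J hJ
    refine ⟨by simp, fun r hr => ?_⟩
    simp only [Finset.coe_insert, Set.mem_insert_iff] at hr
    rcases hr with rfl | rfl | hr
    · exact zero_le
    · exact le_rfl
    · exact hJ hr
  have htrim : (Q : Measure Path).trim hle = (doobMeasure W u x t).trim hle := by
    refine ext_of_generate_finite _ (generateFrom_piiUnionInter_measurableSet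
      (fun r => MeasurableSpace.comap (fun w : Path => w r) inferInstance) (Set.Iic t)).symm
      (isPiSystem_piiUnionInter _ (fun r => @MeasurableSpace.isPiSystem_measurableSet _
        (MeasurableSpace.comap (fun w : Path => w r) inferInstance)) _)
      (fun C hC => ?_) ?_
    · rw [trim_measurableSet_eq hle (measurableSet_iSup_of_mem_piiUnionInter _ _ _ hC),
        trim_measurableSet_eq hle (measurableSet_iSup_of_mem_piiUnionInter _ _ _ hC)]
      obtain ⟨J, hJ, F, hF, rfl⟩ := hC
      choose! B hB hBF using hF
      have h := measure_cylinder_eq hW hx hQ (insert t J) t (hgreat J hJ)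
        (fun r => if r ∈ J then B r else Set.univ) (fun r => by
          split_ifs with hr
          · exact hB r hr
          · exact MeasurableSet.univ)
      convert h using 2 <;>
      · ext w
        simp only [Set.mem_iInter, Set.mem_ofPred_eq]
        constructor
        · intro hw r _
          split_ifs with hr
          · have := hw r hr
            rwa [← hBF r hr] at this
          · trivial
        · intro hw r hr
          have := hw r (by simp [hr])
          rw [if_pos hr] at this
          rw [← hBF r hr]
          exact this
    · rw [trim_measurableSet_eq hle MeasurableSet.univ,
        trim_measurableSet_eq hle MeasurableSet.univ]
      have h := measure_cylinder_eq hW hx hQ (insert t ∅) t (hgreat ∅ (by simp))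
        (fun _ => Set.univ) (fun _ => MeasurableSet.univ)
      simpa using h
  rw [← trim_measurableSet_eq hle hA, htrim, trim_measurableSet_eq hle hA]

/-! ### Convergence -/

theorem lt_exitTime_of_lt_exitTime_zero {c : ℝ} (hc : 0 ≤ c) (hx : x ∈ Set.Ioo 0 u) {w : Path}
    (hw0 : w 0 = x) {t : ℝ≥0} (ht : (t : ℝ≥0∞) < exitTime 0 u w) :
    (t : ℝ≥0∞) < exitTime c u w := by
  rw [lt_exitTime_iff]
  intro s hs
  have h := mem_Ioo_of_lt_exitTime_zero hx hw0 ht hs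
  have : 0 ≤ c * (s : ℝ) := by positivity
  exact ⟨h.1.ne', (h.2.trans_le (by linarith)).ne⟩

/-- The lower half of the convergence of the laws on each `ℱ_t`. -/
theorem measure_le_liminf {Q : ℝ → ProbabilityMeasure Path} {Qlim : ProbabilityMeasure Path}
    (hW : IsWienerMeasure W) (hx : x ∈ Set.Ioo 0 u)
    (hQ : ∀ c ∈ Set.Ioo (0 : ℝ) 1, IsConeConditionedLaw W c u x (Q c))
    (hQlim : IsDoobConditionedLaw W u x Qlim) {t : ℝ≥0} {A : Set Path}
    (hA : MeasurableSet[canonicalFiltration t] A) :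
    (Qlim : Measure Path) A ≤ liminf (fun c => (Q c : Measure Path) A) (𝓝[>] (0 : ℝ)) := by
  have := isProbabilityMeasure_wienerFrom hW x
  have hA' := canonicalFiltration.le t _ hA
  have hu : 0 < u := hx.1.trans hx.2
  have h0 := wienerFrom_eval_zero hW x
  set f : Path → ℝ := {w : Path | (t : ℝ≥0∞) < exitTime 0 u w}.indicator (doobDensity u x t)
    with hfd
  set g : ℝ → Path → ℝ := fun c => {w : Path | (t : ℝ≥0∞) < exitTime c u w}.indicator
    fun w => phi0Scaled c (w t) ((t : ℝ) + u / c) / phi0Scaled c x (u / c) with hgd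
  have hf0 : ∀ w : Path, w 0 = x → 0 ≤ f w := fun w hw =>
    Set.indicator_apply_nonneg fun h => (doobDensity_pos hx hw h).le
  set M := Real.exp (Real.pi ^ 2 / u ^ 2 * ((t : ℝ) / 2)) / intervalEigenfunction u x
  have hfM : ∀ w, f w ≤ M := fun w => Set.indicator_apply_le' (fun _ => doobDensity_le hx t w)
    fun _ => div_nonneg (Real.exp_pos _).le (intervalEigenfunction_pos hx).le
  have hfm : Measurable f := (measurable_doobDensity u x t).indicator
    (measurableSet_lt_exitTime 0 u t)
  have hgint : ∀ c ∈ Set.Ioo (0 : ℝ) 1, Integrable (g c) (wienerFrom W x) := by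
    intro c hc
    rw [hgd, integrable_indicator_iff (measurableSet_lt_exitTime c u t)]
    -- The integral of `g c` is the total mass `1` of `Q c`, whereas a nonintegrable function has
    -- integral `0`.
    refine .of_integral_ne_zero ?_
    have h := hQ c hc t Set.univ (@MeasurableSet.univ _ (canonicalFiltration t))
    rw [Set.inter_univ, probReal_univ] at h
    rw [← h]
    exact (one_ne_zero : (1 : ℝ) ≠ 0)
  have hg0 : ∀ᶠ c in 𝓝[>] (0 : ℝ), ∀ w : Path, w 0 = x → 0 ≤ g c w := by
    filter_upwards [eventually_phi0Scaled_nonneg hu t.coe_nonneg,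
      eventually_phi0Scaled_nonneg hu le_rfl] with c hc1 hc2 w hw
    refine Set.indicator_apply_nonneg fun h => div_nonneg (hc1 _ ?_) ?_
    · exact Set.Ioo_subset_Icc_self (mem_Ioo_of_lt_exitTime hx.1 hx.2 hw h le_rfl)
    · simpa using hc2 x ⟨hx.1.le, by simpa using hx.2.le⟩
  have hlim : Tendsto (fun c => ∫ w in A, min (g c w) (f w) ∂(wienerFrom W x)) (𝓝[>] (0 : ℝ))
      (𝓝 (∫ w in A, f w ∂(wienerFrom W x))) := by
    refine tendsto_integral_filter_of_dominated_convergence (fun _ => M) ?_ ?_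
      (integrable_const M) ?_
    · filter_upwards [Ioo_mem_nhdsGT one_pos] with c hc
      exact ((hgint c hc).aestronglyMeasurable.inf hfm.aestronglyMeasurable).restrict
    · filter_upwards [hg0] with c hc
      filter_upwards [ae_restrict_of_ae h0] with w hw
      rw [Real.norm_of_nonneg (le_min (hc w hw) (hf0 w hw))]
      exact (min_le_right _ _).trans (hfM w)
    · filter_upwards [ae_restrict_of_ae h0] with w hw
      by_cases h : (t : ℝ≥0∞) < exitTime 0 u w
      · have hfw : f w = doobDensity u x t w := Set.indicator_of_mem (by exact h) _
        have hgw : Tendsto (fun c => g c w) (𝓝[>] 0) (𝓝 (f w)) := by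
          rw [hfw]
          refine (tendsto_phi0Scaled_ratio hx t.coe_nonneg (w t)).congr' ?_
          filter_upwards [self_mem_nhdsWithin] with c hc
          have hmem : w ∈ {w : Path | (t : ℝ≥0∞) < exitTime c u w} :=
            lt_exitTime_of_lt_exitTime_zero (le_of_lt hc) hx hw h
          simp only [hgd]
          rw [Set.indicator_of_mem hmem]
        simpa using hgw.min (tendsto_const_nhds (x := f w))
      -- Outside `{T > t}` the minimum is `0` as soon as `g c` is nonnegative, whether or not the
      -- path leaves the moving interval before `t`.
      · have hfw : f w = 0 := Set.indicator_of_notMem (by exact h) _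
        rw [hfw]
        refine tendsto_const_nhds.congr' ?_
        filter_upwards [hg0] with c hc
        exact (min_eq_right (hc w hw)).symm
  have hQf : (Qlim : Measure Path) A = ENNReal.ofReal (∫ w in A, f w ∂(wienerFrom W x)) := by
    have := isFiniteMeasure_doobMeasure hW hx t
    rw [measure_eq_doobMeasure hW hx hQlim hA, hfd,
      setIntegral_indicator (measurableSet_lt_exitTime 0 u t), Set.inter_comm,
      ← measureReal_doobMeasure hW hx t hA', ofReal_measureReal]
  rw [hQf, ← ((ENNReal.continuous_ofReal.tendsto _).comp hlim).liminf_eq]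
  refine liminf_le_liminf ?_
  filter_upwards [Ioo_mem_nhdsGT one_pos, hg0] with c hc hcg
  rw [← ofReal_measureReal (μ := (Q c : Measure Path)), hQ c hc t A hA, Set.inter_comm,
    ← setIntegral_indicator (measurableSet_lt_exitTime c u t)]
  refine ENNReal.ofReal_le_ofReal (integral_mono_of_nonneg ?_ (hgint c hc).restrict ?_)
  · filter_upwards [ae_restrict_of_ae h0] with w hw using le_min (hcg w hw) (hf0 w hw)
  · exact Eventually.of_forall fun w => min_le_left _ _

end ConditionedBM

theorem mainTheorem2
    (W : Measure ConditionedBM.Path) (hW : ConditionedBM.IsWienerMeasure W)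
    (x u : ℝ) (hx : 0 < x) (hxu : x < u)
    (Q : ℝ → ProbabilityMeasure ConditionedBM.Path)
    (hQ : ∀ c ∈ Set.Ioo (0 : ℝ) 1, ConditionedBM.IsConeConditionedLaw W c u x (Q c))
    (Qlim : ProbabilityMeasure ConditionedBM.Path)
    (hQlim : ConditionedBM.IsDoobConditionedLaw W u x Qlim) :
    Tendsto Q (𝓝[>] (0 : ℝ)) (𝓝 Qlim) := by
  refine tendsto_of_forall_isOpen_le_liminf' fun U hU => ?_
  obtain ⟨V, hmono, rfl, hV⟩ := ConditionedBM.exists_monotone_approx_of_isOpen hU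
  rw [hmono.measure_iUnion]
  refine iSup_le fun n => ?_
  obtain ⟨t, ht⟩ := hV n
  exact (ConditionedBM.measure_le_liminf hW ⟨hx, hxu⟩ hQ hQlim ht).trans
    (liminf_le_liminf (Eventually.of_forall fun c => measure_mono (Set.subset_iUnion V n)))
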